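/- Let $(\Omega,\mathcal F,\mathbb P)$ be a probability space and $\mathbb X=(X_n)_{n\ge1}$ a strictly stationary sequence of real random variables on it. Let $\mathcal I^{\mathbb X}$ be the $\sigma$-field of all sets $A\subseteq\Omega$ for which there is a Borel set $B\subseteq\mathbb R^{\mathbb N}$ with $A=\{\omega:(X_i(\omega),X_{i+1}(\omega),\dots)\in B\}$ for every $i\ge1$. Let $\gamma=\gamma_1(X_1\mid\mathcal I^{\mathbb X})$ be (any version of) the conditional right endpoint of the support of $X_1$ given $\mathcal I^{\mathbb X}$, that is, an $\mathcal I^{\mathbb X}$-measurable function $\gamma:\Omega\to[-\infty,\infty]$ such that $\mathbb P(X_1\le\gamma\mid\mathcal I^{\mathbb X})=1$ a.s. and such that $\gamma\le\gamma'$ a.s. for every $\mathcal I^{\mathbb X}$-measurable $\gamma':\Omega\to[-\infty,\infty]$ with $\mathbb P(X_1\le\gamma'\mid\mathcal I^{\mathbb X})=1$ a.s. Let $a>0$, and let $(k_n)_{n\ge1}$ be integers with $1\le k_n\le n$ for all $n$ and $k_n/n\to1$. Put $$K(k_n,n,a)=\#\{1\le i\le n:\ X_{k_n:n}-a<X_i<X_{k_n:n}\},$$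 where $X_{1:n}\le\dots\le X_{n:n}$ are the order statistics of $X_1,\dots,X_n$. (i) If $\mathbb P(X_1=\gamma)=0$ and $\mathbb P(X_1=\gamma-a)=0$, then, almost surely, as $n\to\infty$, $$\frac{K(k_n,n,a)}n\longrightarrow I(\gamma<\infty)\cdot\mathbb P\bigl(X_1>\gamma-a\mid\mathcal I^{\mathbb X}\bigr).$$ In particular, for $\mathbb P$-almost every $\omega$ with $\gamma(\omega)=\infty$, $K(k_n,n,a)(\omega)/n\to0$. (ii) If $\gamma=\infty$ almost surely, then $K(k_n,n,a)/n\to0$ almost surely (without the two conditions in (i)). -/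

import Mathlib

open MeasureTheory ProbabilityTheory Filter Topology

noncomputable section

namespace NearMax

/-- A sequence of real random variables (`X 0` is the first one) is strictly stationary if the law
on `ℝ^ℕ` of every time-shifted sequence is the law of the sequence itself. -/
def StrictlyStationary {Ω : Type*} [MeasurableSpace Ω] (P : Measure Ω) (X : ℕ → Ω → ℝ) : Prop :=
  ∀ h : ℕ, IdentDistrib (fun ω (i : ℕ) => X (i + h) ω) (fun ω (i : ℕ) => X i ω) P P

/-- The sigma-field of the events that are invariant with respect to the sequence `X`: the sets `A`
for which there is one Borel set `B` of `ℝ^ℕ` with `A = {ω | (X_i(ω), X_{i+1}(ω), …) ∈ B}` for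
every `i`. -/
@[reducible] def invariantSigma {Ω : Type*} (X : ℕ → Ω → ℝ) : MeasurableSpace Ω where
  MeasurableSet' A := ∃ B : Set (ℕ → ℝ), MeasurableSet B ∧
    ∀ i : ℕ, A = {ω | (fun j : ℕ => X (i + j) ω) ∈ B}
  measurableSet_empty := ⟨∅, MeasurableSet.empty, fun i => by simp⟩
  measurableSet_compl := by
    rintro A ⟨B, hB, h⟩
    refine ⟨Bᶜ, hB.compl, fun i => ?_⟩
    rw [h i]
    rfl
  measurableSet_iUnion := by
    intro f hf
    choose B hB h using hf
    refine ⟨⋃ n, B n, MeasurableSet.iUnion hB, fun i => ?_⟩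
    ext ω
    simp only [Set.mem_iUnion, Set.mem_ofPred_eq]
    refine exists_congr fun n => ?_
    rw [h n i]
    rfl

lemma invariantSigma_le {Ω : Type*} [mΩ : MeasurableSpace Ω] {X : ℕ → Ω → ℝ}
    (hX : ∀ i, Measurable (X i)) : invariantSigma X ≤ mΩ := by
  rintro A ⟨B, hB, h⟩
  rw [h 0]
  exact (measurable_pi_lambda _ fun j => hX (0 + j)) hB

/-- The extended random variable `Q` is (a version of) the conditional right endpoint of the support
of `X` given the sigma-field `G`. -/
structure IsCondRightEndpoint {Ω : Type*} (G : MeasurableSpace Ω) [MeasurableSpace Ω]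
    (P : Measure Ω) (X : Ω → ℝ) (Q : Ω → EReal) : Prop where
  measurable : Measurable[G] Q
  condProb_eq_one : P⟦{ω | (X ω : EReal) ≤ Q ω} | G⟧ =ᵐ[P] fun _ => (1 : ℝ)
  le_of_condProb_eq_one : ∀ Q' : Ω → EReal, Measurable[G] Q' →
    (P⟦{ω | (X ω : EReal) ≤ Q' ω} | G⟧ =ᵐ[P] fun _ => (1 : ℝ)) → Q ≤ᵐ[P] Q'

/-- The `k`-th smallest of the first `n` terms `x 0, …, x (n - 1)` of a sequence, for `1 ≤ k ≤ n`
(the value for other `k` is irrelevant). -/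
def orderStat (x : ℕ → ℝ) (k n : ℕ) : ℝ :=
  if h : 1 ≤ k ∧ k ≤ n then
    (fun i : Fin n => x i) (Tuple.sort (fun i : Fin n => x i) ⟨k - 1, by omega⟩)
  else 0

/-- The number of those among the first `n` terms of a sequence that lie in the open interval
of length `a` to the left of the `k`-th order statistic of these `n` terms. -/
def nearCount (x : ℕ → ℝ) (k n : ℕ) (a : ℝ) : ℕ :=
  ((Finset.range n).filter fun i => orderStat x k n - a < x i ∧ x i < orderStat x k n).card

/-- For an event, to have conditional probability one means to be almost sure. -/
lemma condProb_eq_one_iff {Ω : Type*} {G : MeasurableSpace Ω} [mΩ : MeasurableSpace Ω] (P : Measure Ω)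
    [IsProbabilityMeasure P] (hG : G ≤ mΩ) {A : Set Ω}
    (hA : MeasurableSet A) :
    (P⟦A | G⟧ =ᵐ[P] fun _ => (1 : ℝ)) ↔ ∀ᵐ ω ∂P, ω ∈ A := by
  constructor
  · intro h
    have h1 : ∫ ω, (P⟦A | G⟧) ω ∂P = 1 := by
      rw [integral_congr_ae h]; simp
    rw [integral_condExp hG, integral_indicator_const (1 : ℝ) hA] at h1
    have h2 : P.real A = 1 := by simpa using h1
    have h3 : P A = 1 := by simpa [measureReal_def, ENNReal.toReal_eq_one_iff] using h2
    exact (mem_ae_iff_prob_eq_one hA).mpr h3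
  · intro h
    have h1 : A.indicator (fun _ => (1 : ℝ)) =ᵐ[P] fun _ => (1 : ℝ) := by
      filter_upwards [h] with ω hω
      simp [hω]
    refine (condExp_congr_ae h1).trans ?_
    rw [condExp_const hG]

/-- Every random variable has a conditional right endpoint given any sub-sigma-field. -/
theorem exists_isCondRightEndpoint {Ω : Type*} {G : MeasurableSpace Ω} [mΩ : MeasurableSpace Ω]
    (P : Measure Ω) [IsProbabilityMeasure P] {X : Ω → ℝ} (hX : Measurable X) (hG : G ≤ mΩ) : ∃ Q : Ω → EReal, IsCondRightEndpoint G P X Q := by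
  classical
  let f : ℚ → Ω → ℝ := fun q => P⟦{ω | (q : ℝ) < X ω} | G⟧
  have hf : ∀ q, Measurable[G] (f q) := fun q => stronglyMeasurable_condExp.measurable
  have hE : ∀ q, MeasurableSet[G] {ω | f q ω = 0} := fun q => (hf q) (measurableSet_singleton 0)
  have hXq : ∀ q : ℚ, MeasurableSet {ω | (q : ℝ) < X ω} := fun q => measurableSet_lt measurable_const hX
  have hint : ∀ q : ℚ, Integrable ({ω | (q : ℝ) < X ω}.indicator fun _ => (1 : ℝ)) P :=
    fun q => (integrable_const _).indicator (hXq q)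
  have key : ∀ (q : ℚ) (s : Set Ω), MeasurableSet[G] s →
      ∫ ω in s, f q ω ∂P = P.real ({ω | (q : ℝ) < X ω} ∩ s) := by
    intro q s hs
    rw [setIntegral_condExp hG (hint q) hs, integral_indicator_const (1 : ℝ) (hXq q)]
    simp [measureReal_restrict_apply (hXq q)]
  have hmeas : ∀ Q' : Ω → EReal, Measurable[G] Q' → MeasurableSet {ω | (X ω : EReal) ≤ Q' ω} :=
    fun Q' hQ' => measurableSet_le hX.coe_real_ereal (hQ'.mono hG le_rfl)
  let Q : Ω → EReal := fun ω => ⨅ q : ℚ, if f q ω = 0 then ((q : ℝ) : EReal) else ⊤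
  have hQ : Measurable[G] Q :=
    Measurable.iInf fun q => Measurable.ite (hE q) measurable_const measurable_const
  refine ⟨Q, hQ, ?_, ?_⟩
  · rw [condProb_eq_one_iff P hG (hmeas Q hQ)]
    have h : ∀ q : ℚ, ∀ᵐ ω ∂P, f q ω = 0 → X ω ≤ q := by
      intro q
      have h0 : P.real ({ω | (q : ℝ) < X ω} ∩ {ω | f q ω = 0}) = 0 := by
        rw [← key q _ (hE q)]
        exact setIntegral_eq_zero_of_forall_eq_zero fun ω hω => hω
      rw [measureReal_eq_zero_iff] at h0
      have h1 := measure_eq_zero_iff_ae_notMem.mp h0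
      filter_upwards [h1] with ω hω h2
      by_contra h3
      exact hω ⟨not_le.mp h3, h2⟩
    filter_upwards [ae_all_iff.mpr h] with ω hω
    refine le_iInf fun q => ?_
    split_ifs with h2
    · exact_mod_cast hω q h2
    · exact le_top
  · intro Q' hQ' h
    rw [condProb_eq_one_iff P hG (hmeas Q' hQ')] at h
    have h' : ∀ q : ℚ, ∀ᵐ ω ∂P, Q' ω ≤ ((q : ℝ) : EReal) → f q ω = 0 := by
      intro q
      have hs : MeasurableSet[G] {ω | Q' ω ≤ ((q : ℝ) : EReal)} := hQ' measurableSet_Iic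
      have h0 : ∫ ω in {ω | Q' ω ≤ ((q : ℝ) : EReal)}, f q ω ∂P = 0 := by
        rw [key q _ hs, measureReal_eq_zero_iff, measure_eq_zero_iff_ae_notMem]
        filter_upwards [h] with ω hω h2
        have h3 : ((q : ℝ) : EReal) < X ω := by exact_mod_cast h2.1
        exact absurd (h3.trans_le (hω.trans h2.2)) (lt_irrefl _)
      have hnn : 0 ≤ᵐ[P] f q := condExp_nonneg (Eventually.of_forall fun ω =>
        Set.indicator_nonneg (fun _ _ => zero_le_one) ω)
      rw [setIntegral_eq_zero_iff_of_nonneg_ae (ae_restrict_of_ae hnn)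
        integrable_condExp.integrableOn] at h0
      exact (ae_restrict_iff' (hG _ hs)).mp h0
    filter_upwards [ae_all_iff.mpr h'] with ω hω
    by_contra hlt
    obtain ⟨q, hq1, hq2⟩ := EReal.lt_iff_exists_rat_btwn.mp (not_le.mp hlt)
    refine absurd hq2 (not_lt.mpr ?_)
    refine (iInf_le _ q).trans ?_
    rw [if_pos (hω q hq1.le)]

end NearMax

end

/-!
The invariant σ-field is the pullback, under the path map, of the σ-field of shift-invariant sets
of sequences. Birkhoff's ergodic theorem therefore makes the empirical distribution functions
`F_n` converge, almost surely and at every rational point, to the conditional distribution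
function `F` of `X₁` given the invariant σ-field.

By stationarity all `X_i` lie below `γ`, while `F < 1` strictly below `γ`; as `k_n / n → 1`, the
order statistics `M_n = X_{k_n:n}` converge to `γ`. Now `K / n` lies between
`F_n (M_n - ε_n) - F_n (M_n - a)`, for any `ε_n > 0` tending to zero, and `1 - F_n (M_n - a)`. If
`γ = ∞`, the upper bound tends to zero. If `γ < ∞`, the absence of atoms at `γ` and `γ - a` makes
`F` continuous at these points, so both bounds tend to `1 - F (γ - a)`.
-/

noncomputable section

namespace NearMax

section BirkhoffErgodic

variable {S : Type*} {T : S → S} {g : S → ℝ}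

lemma partialSups_birkhoffSum_succ (T : S → S) (g : S → ℝ) (n : ℕ) (x : S) :
    partialSups (birkhoffSum T g · x) (n + 1)
      = max 0 (g x + partialSups (birkhoffSum T g · (T x)) n) := by
  induction n with
  | zero => rw [partialSups_add_one]; simp
  | succ n ih =>
    rw [partialSups_add_one, ih, birkhoffSum_succ', partialSups_add_one _ n, max_assoc,
      max_add_add_left]

lemma partialSups_birkhoffSum_nonneg (T : S → S) (g : S → ℝ) (n : ℕ) (x : S) :
    0 ≤ partialSups (birkhoffSum T g · x) n := by
  simpa using le_partialSups_of_le (birkhoffSum T g · x) (Nat.zero_le n)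

lemma bddAbove_range_birkhoffSum_apply (T : S → S) (g : S → ℝ) (x : S) :
    BddAbove (Set.range (birkhoffSum T g · (T x))) ↔
      BddAbove (Set.range (birkhoffSum T g · x)) := by
  simp only [bddAbove_def, Set.forall_mem_range]
  constructor <;> rintro ⟨C, hC⟩
  · refine ⟨max 0 (g x + C), fun n => ?_⟩
    cases n with
    | zero => simp
    | succ n =>
      rw [birkhoffSum_succ']
      exact le_max_of_le_right (by gcongr; exact hC n)
  · refine ⟨C - g x, fun n => ?_⟩
    have := hC (n + 1)
    rw [birkhoffSum_succ'] at this
    linarith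

variable [MeasurableSpace S] {μ : Measure S}

lemma measurable_birkhoffSum (hT : Measurable T) (hg : Measurable g) (n : ℕ) :
    Measurable (birkhoffSum T g n) :=
  Finset.measurable_sum (Finset.range n) fun k _ => hg.comp (hT.iterate k)

lemma integrable_birkhoffSum (hT : MeasurePreserving T μ μ) (hg : Integrable g μ) (n : ℕ) :
    Integrable (birkhoffSum T g n) μ :=
  integrable_finsetSum (Finset.range n) fun k _ => (hT.iterate k).integrable_comp_of_integrable hg

lemma integrable_partialSups_birkhoffSum (hT : MeasurePreserving T μ μ) (hg : Integrable g μ)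
    (n : ℕ) : Integrable (fun x => partialSups (birkhoffSum T g · x) n) μ := by
  induction n with
  | zero => simp
  | succ n ih =>
    simp only [partialSups_add_one]
    exact ih.sup (integrable_birkhoffSum hT hg (n + 1))

lemma measurableSet_invariants_not_bddAbove_birkhoffSum (hT : Measurable T) (hg : Measurable g) :
    MeasurableSet[MeasurableSpace.invariants T]
      {x | ¬ BddAbove (Set.range (birkhoffSum T g · x))} :=
  MeasurableSpace.measurableSet_invariants.mpr
    ⟨(measurableSet_bddAbove_range (measurable_birkhoffSum hT hg)).compl, by
      ext x; simp [bddAbove_range_birkhoffSum_apply]⟩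

lemma setIntegral_max_neg_partialSups_birkhoffSum_nonneg (hT : MeasurePreserving T μ μ)
    (hg : Integrable g μ) {A : Set S} (hA : MeasurableSet[MeasurableSpace.invariants T] A) (n : ℕ) :
    0 ≤ ∫ x in A, max (-partialSups (birkhoffSum T g · (T x)) n) (g x) ∂μ := by
  obtain ⟨hAm, hAinv⟩ := MeasurableSpace.measurableSet_invariants.mp hA
  set Φ : ℕ → S → ℝ := fun n x => partialSups (birkhoffSum T g · x) n
  have hΦ : ∀ n, Integrable (Φ n) μ := integrable_partialSups_birkhoffSum hT hg
  have increment : ∀ x, max (-Φ n (T x)) (g x) = Φ (n + 1) x - Φ n (T x) := fun x => by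
    simp only [Φ, partialSups_birkhoffSum_succ, ← max_sub_sub_right, zero_sub, add_sub_cancel_right]
  have invariance : ∫ x in A, Φ n (T x) ∂μ = ∫ x in A, Φ n x ∂μ := by
    have := setIntegral_map (μ := μ) (f := Φ n) hAm
      (by rw [hT.map_eq]; exact (hΦ n).aestronglyMeasurable) hT.aemeasurable
    rwa [hT.map_eq, hAinv, eq_comm] at this
  calc 0 ≤ ∫ x in A, Φ (n + 1) x ∂μ - ∫ x in A, Φ n x ∂μ :=
        sub_nonneg.mpr <| setIntegral_mono (hΦ n).integrableOn (hΦ (n + 1)).integrableOn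
          fun x => (partialSups (birkhoffSum T g · x)).monotone n.le_succ
    _ = ∫ x in A, max (-Φ n (T x)) (g x) ∂μ := by
        simp only [increment]
        rw [← invariance]
        exact (integral_sub (hΦ (n + 1)).integrableOn
          (hT.integrable_comp_of_integrable (hΦ n)).integrableOn).symm

theorem setIntegral_not_bddAbove_birkhoffSum_nonneg (hT : MeasurePreserving T μ μ)
    (hgm : Measurable g) (hg : Integrable g μ) :
    0 ≤ ∫ x in {x | ¬ BddAbove (Set.range (birkhoffSum T g · x))}, g x ∂μ := by
  set A := {x | ¬ BddAbove (Set.range (birkhoffSum T g · x))}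
  have hA : MeasurableSet[MeasurableSpace.invariants T] A :=
    measurableSet_invariants_not_bddAbove_birkhoffSum hT.measurable hgm
  refine ge_of_tendsto' (tendsto_integral_of_dominated_convergence (fun x => |g x|) (fun n => ?_)
      hg.abs.integrableOn (fun n => ae_of_all _ fun x => ?_) ?_)
    (setIntegral_max_neg_partialSups_birkhoffSum_nonneg hT hg hA)
  · exact ((hT.integrable_comp_of_integrable
      (integrable_partialSups_birkhoffSum hT hg n)).neg.sup hg).aestronglyMeasurable.restrict
  · have := partialSups_birkhoffSum_nonneg T g n (T x)
    rw [Real.norm_eq_abs, abs_le]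
    exact ⟨(neg_abs_le (g x)).trans (le_max_right _ _),
      max_le ((neg_nonpos.mpr this).trans (abs_nonneg _)) (le_abs_self _)⟩
  · refine ae_restrict_of_forall_mem (MeasurableSpace.invariants_le T _ hA) fun x hx => ?_
    have divergence : Tendsto (partialSups (birkhoffSum T g · (T x))) atTop atTop :=
      tendsto_atTop_atTop_of_monotone' (partialSups _).monotone <| by
        rwa [bddAbove_range_partialSups, bddAbove_range_birkhoffSum_apply]
    refine tendsto_const_nhds.congr' ?_
    filter_upwards [divergence.eventually_ge_atTop (-g x)] with n hn
    exact (max_eq_right (neg_le.mp hn)).symm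

lemma ae_bddAbove_birkhoffSum_of_condExp_neg [IsFiniteMeasure μ] (hT : MeasurePreserving T μ μ)
    (hgm : Measurable g) (hg : Integrable g μ)
    (hneg : ∀ᵐ x ∂μ, (μ[g | MeasurableSpace.invariants T]) x < 0) :
    ∀ᵐ x ∂μ, BddAbove (Set.range (birkhoffSum T g · x)) := by
  set A := {x | ¬ BddAbove (Set.range (birkhoffSum T g · x))}
  have hA : MeasurableSet[MeasurableSpace.invariants T] A :=
    measurableSet_invariants_not_bddAbove_birkhoffSum hT.measurable hgm
  have hle := MeasurableSpace.invariants_le T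
  have integral_nonneg : 0 ≤ ∫ x in A, (μ[g | MeasurableSpace.invariants T]) x ∂μ := by
    rw [setIntegral_condExp hle hg hA]
    exact setIntegral_not_bddAbove_birkhoffSum_nonneg hT hgm hg
  have condExp_eq_zero : ∀ᵐ x ∂μ, x ∈ A → (μ[g | MeasurableSpace.invariants T]) x = 0 := by
    have neg_nonneg : 0 ≤ᵐ[μ.restrict A] -μ[g | MeasurableSpace.invariants T] :=
      ae_restrict_of_ae (hneg.mono fun x hx => (neg_pos.mpr hx).le)
    have integral_eq_zero : ∫ x in A, (-μ[g | MeasurableSpace.invariants T]) x ∂μ = 0 :=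
      le_antisymm (by simpa [integral_neg] using integral_nonneg)
        (integral_nonneg_of_ae neg_nonneg)
    have := (setIntegral_eq_zero_iff_of_nonneg_ae neg_nonneg
      integrable_condExp.neg.integrableOn).mp integral_eq_zero
    filter_upwards [(ae_restrict_iff' (hle _ hA)).mp this] with x hx hxA
    exact neg_eq_zero.mp (hx hxA)
  filter_upwards [hneg, condExp_eq_zero] with x hx hx'
  by_contra hxA
  exact hx.ne (hx' hxA)

lemma ae_eventually_birkhoffAverage_lt [IsFiniteMeasure μ] (hT : MeasurePreserving T μ μ)
    {f : S → ℝ} (hfm : Measurable f) (hf : Integrable f μ) {ε : ℝ} (hε : 0 < ε) :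
    ∀ᵐ x ∂μ, ∀ᶠ n in atTop,
      birkhoffAverage ℝ T f n x < (μ[f | MeasurableSpace.invariants T]) x + ε := by
  have hle := MeasurableSpace.invariants_le T
  set u : S → ℝ := fun x => (μ[f | MeasurableSpace.invariants T]) x + ε / 2
  have hu : Measurable[MeasurableSpace.invariants T] u :=
    stronglyMeasurable_condExp.measurable.add_const _
  have hui : Integrable u μ := integrable_condExp.add (integrable_const _)
  have condExp_neg : ∀ᵐ x ∂μ, (μ[f - u | MeasurableSpace.invariants T]) x < 0 := by
    filter_upwards [condExp_sub hf hui (MeasurableSpace.invariants T)] with x hx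
    rw [hx, Pi.sub_apply, condExp_of_stronglyMeasurable hle hu.stronglyMeasurable hui]
    simp only [u]
    linarith
  filter_upwards [ae_bddAbove_birkhoffSum_of_condExp_neg hT (hfm.sub (hu.mono hle le_rfl))
    (hf.sub hui) condExp_neg] with x ⟨C, hC⟩
  filter_upwards [(tendsto_const_div_atTop_nhds_zero_nat C).eventually_lt_const (half_pos hε),
    eventually_ne_atTop 0] with n hn hn0
  have average_sub_le : birkhoffAverage ℝ T f n x - u x ≤ C / n := by
    rw [← birkhoffAverage_of_comp_eq ℝ (MeasurableSpace.comp_eq_of_measurable_invariants hu)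
      (Nat.cast_ne_zero.mpr hn0), ← Pi.sub_apply, ← Pi.sub_apply, ← birkhoffAverage_sub,
      birkhoffAverage, smul_eq_mul, inv_mul_eq_div]
    gcongr
    exact hC ⟨n, rfl⟩
  simp only [u] at average_sub_le
  linarith

theorem ae_tendsto_birkhoffAverage [IsFiniteMeasure μ] (hT : MeasurePreserving T μ μ)
    {f : S → ℝ} (hf : Integrable f μ) :
    ∀ᵐ x ∂μ, Tendsto (birkhoffAverage ℝ T f · x) atTop
      (𝓝 ((μ[f | MeasurableSpace.invariants T]) x)) := by
  wlog hfm : Measurable f generalizing f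
  · obtain ⟨f', hf'm, hff'⟩ := hf.1.aemeasurable
    filter_upwards [this (hf.congr hff') hf'm, condExp_congr_ae (m := .invariants T) hff',
      ae_all_iff.mpr (hT.quasiMeasurePreserving.birkhoffAverage_ae_eq_of_ae_eq ℝ hff')]
      with x hx hcond havg
    simpa only [hcond, havg] using hx
  have upper := ae_all_iff.mpr fun j : ℕ =>
    ae_eventually_birkhoffAverage_lt hT hfm hf (Nat.one_div_pos_of_nat (n := j))
  have lower := ae_all_iff.mpr fun j : ℕ =>
    ae_eventually_birkhoffAverage_lt hT hfm.neg hf.neg (Nat.one_div_pos_of_nat (n := j))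
  filter_upwards [upper, lower, condExp_neg f (MeasurableSpace.invariants T)]
    with x upper lower hneg
  rw [Metric.tendsto_nhds]
  intro ε hε
  obtain ⟨j, hj⟩ := exists_nat_one_div_lt hε
  filter_upwards [upper j, lower j] with n hn hn'
  simp only [birkhoffAverage_neg, hneg, Pi.neg_apply] at hn'
  rw [Real.dist_eq, abs_lt]
  constructor <;> linarith

end BirkhoffErgodic

section StationarySequence

lemma condExp_map_comp_ae_eq {Ω S : Type*} {m : MeasurableSpace S} [mΩ : MeasurableSpace Ω]
    [mS : MeasurableSpace S] {P : Measure Ω} [IsFiniteMeasure P] {Y : Ω → S} (hY : Measurable Y)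
    (hm : m ≤ mS) {f : S → ℝ} (hf : Integrable f (P.map Y)) :
    (fun ω => ((P.map Y)[f | m]) (Y ω)) =ᵐ[P] P[fun ω => f (Y ω) | m.comap Y] := by
  have hle : m.comap Y ≤ mΩ := (MeasurableSpace.comap_mono hm).trans hY.comap_le
  have integrable_condExp_comp : Integrable (fun ω => ((P.map Y)[f | m]) (Y ω)) P :=
    integrable_condExp.comp_measurable hY
  refine ae_eq_condExp_of_forall_setIntegral_eq hle (hf.comp_measurable hY)
    (fun _ _ _ => integrable_condExp_comp.integrableOn) ?_
    (stronglyMeasurable_condExp.comp_measurable (comap_measurable Y)).aestronglyMeasurable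
  rintro _ ⟨B, hB, rfl⟩ -
  rw [← setIntegral_map (hm _ hB) integrable_condExp.aestronglyMeasurable hY.aemeasurable,
    ← setIntegral_map (hm _ hB) hf.aestronglyMeasurable hY.aemeasurable,
    setIntegral_condExp hm hf hB]

/-- The one-sided shift on the space of sequences; for a stationary process it preserves the law of
the path. -/
def shift {E : Type*} (x : ℕ → E) : ℕ → E := fun i => x (i + 1)

lemma shift_iterate {E : Type*} (n : ℕ) (x : ℕ → E) : shift^[n] x = fun j => x (n + j) := by
  induction n generalizing x with
  | zero => simp
  | succ n ih => simp only [Function.iterate_succ_apply, ih, shift, Nat.add_right_comm n 1]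

lemma measurable_shift {E : Type*} [MeasurableSpace E] : Measurable (shift (E := E)) :=
  measurable_pi_lambda _ fun i => measurable_pi_apply (i + 1)

lemma measurableSet_invariants_frequently_mem {S : Type*} [MeasurableSpace S] {T : S → S}
    (hT : Measurable T) {B : Set S} (hB : MeasurableSet B) :
    MeasurableSet[MeasurableSpace.invariants T] {x | ∃ᶠ n in atTop, T^[n] x ∈ B} := by
  refine MeasurableSpace.measurableSet_invariants.mpr ⟨?_, ?_⟩
  · have limsup_eq : {x | ∃ᶠ n in atTop, T^[n] x ∈ B} = limsup (fun n => T^[n] ⁻¹' B) atTop := by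
      ext x
      simp [mem_limsup_iff_frequently_mem]
    rw [limsup_eq]
    exact MeasurableSet.measurableSet_limsup fun n => hT.iterate n hB
  · ext x
    change (∃ᶠ n in atTop, T^[n + 1] x ∈ B) ↔ ∃ᶠ n in atTop, T^[n] x ∈ B
    rw [← frequently_map (m := (· + 1)) (P := fun n => T^[n] x ∈ B), map_add_atTop_eq_nat]

variable {Ω : Type*} {X : ℕ → Ω → ℝ}

/-- The process `X` as a single random element of the sequence space. -/
def path (X : ℕ → Ω → ℝ) (ω : Ω) : ℕ → ℝ := fun i => X i ω

lemma shift_iterate_path (X : ℕ → Ω → ℝ) (i : ℕ) (ω : Ω) :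
    shift^[i] (path X ω) = fun j => X (i + j) ω :=
  shift_iterate i (path X ω)

lemma invariantSigma_eq_comap (X : ℕ → Ω → ℝ) :
    invariantSigma X = (MeasurableSpace.invariants shift).comap (path X) := by
  refine le_antisymm ?_ ?_
  · rintro A ⟨B, hB, hA⟩
    have mem_iff : ∀ ω i, shift^[i] (path X ω) ∈ B ↔ ω ∈ A := fun ω i => by
      rw [shift_iterate_path, hA i]
      rfl
    refine ⟨_, measurableSet_invariants_frequently_mem measurable_shift hB, ?_⟩
    ext ω
    simp [mem_iff]
  · rintro _ ⟨B, hB, rfl⟩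
    refine ⟨B, MeasurableSpace.invariants_le _ B hB, fun i => ?_⟩
    ext ω
    have preimage_eq : shift^[i] ⁻¹' B = B :=
      (MeasurableSpace.le_invariants_iterate shift i B hB).2
    rw [Set.mem_ofPred_eq, ← shift_iterate_path, ← Set.mem_preimage, preimage_eq]
    rfl

variable [MeasurableSpace Ω] {P : Measure Ω}

lemma measurable_path (hX : ∀ i, Measurable (X i)) : Measurable (path X) :=
  measurable_pi_lambda _ hX

namespace StrictlyStationary

lemma measurePreserving_shift (hstat : StrictlyStationary P X) (hX : ∀ i, Measurable (X i)) :
    MeasurePreserving shift (P.map (path X)) (P.map (path X)) where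
  measurable := measurable_shift
  map_eq := by
    rw [Measure.map_map measurable_shift (measurable_path hX)]
    exact (hstat 1).map_eq

theorem ae_tendsto_birkhoffAverage [IsFiniteMeasure P] (hstat : StrictlyStationary P X)
    (hX : ∀ i, Measurable (X i)) {f : (ℕ → ℝ) → ℝ} (hf : Integrable f (P.map (path X))) :
    ∀ᵐ ω ∂P, Tendsto (birkhoffAverage ℝ shift f · (path X ω)) atTop
      (𝓝 ((P[fun ω => f (path X ω) | invariantSigma X]) ω)) := by
  have hpath := measurable_path hX
  rw [invariantSigma_eq_comap]
  filter_upwards [ae_of_ae_map hpath.aemeasurable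
      (NearMax.ae_tendsto_birkhoffAverage (hstat.measurePreserving_shift hX) hf),
    condExp_map_comp_ae_eq hpath (MeasurableSpace.invariants_le shift) hf] with ω hω hcond
  rwa [← hcond]

lemma measure_inter_preimage_eq (hstat : StrictlyStationary P X) {A : Set Ω}
    (hA : MeasurableSet[invariantSigma X] A) {S : Set ℝ} (hS : MeasurableSet S) (i : ℕ) :
    P (A ∩ X i ⁻¹' S) = P (A ∩ X 0 ⁻¹' S) := by
  obtain ⟨B, hB, hA⟩ := hA
  have inter_eq : ∀ i, A ∩ X i ⁻¹' S =
      (fun ω j => X (j + i) ω) ⁻¹' (B ∩ (fun x => x 0) ⁻¹' S) := fun i => by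
    ext ω
    simp only [Set.mem_inter_iff, Set.mem_preimage, add_comm _ i]
    exact and_congr_left fun _ => by rw [hA i]; rfl
  rw [inter_eq i, inter_eq 0]
  exact (hstat i).measure_preimage_eq (hB.inter (measurable_pi_apply 0 hS))

lemma ae_forall_le (hstat : StrictlyStationary P X) {γ : Ω → EReal}
    (hγ : Measurable[invariantSigma X] γ) (hle : ∀ᵐ ω ∂P, (X 0 ω : EReal) ≤ γ ω) :
    ∀ᵐ ω ∂P, ∀ i, (X i ω : EReal) ≤ γ ω := by
  have null_of_rat : ∀ i, ∀ q : ℚ,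
      P (γ ⁻¹' Set.Iic ((q : ℝ) : EReal) ∩ X i ⁻¹' Set.Ioi (q : ℝ)) = 0 := fun i q => by
    rw [hstat.measure_inter_preimage_eq (hγ measurableSet_Iic) measurableSet_Ioi,
      measure_eq_zero_iff_ae_notMem]
    filter_upwards [hle] with ω hω ⟨hγq, hqX⟩
    exact (hω.trans hγq).not_gt (EReal.coe_lt_coe_iff.mpr hqX)
  filter_upwards [ae_all_iff.mpr fun i => ae_all_iff.mpr fun q =>
    measure_eq_zero_iff_ae_notMem.mp (null_of_rat i q)] with ω hω i
  by_contra! hlt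
  obtain ⟨q, hγq, hqX⟩ := EReal.lt_iff_exists_rat_btwn.mp hlt
  exact hω i q ⟨hγq.le, EReal.coe_lt_coe_iff.mp hqX⟩

end StrictlyStationary

end StationarySequence

section ConditionalLaw

variable {Ω E β : Type*} {G : MeasurableSpace Ω} [mΩ : MeasurableSpace Ω] {P : Measure Ω}

section StandardBorel

variable [MeasurableSpace E] [StandardBorelSpace E] [Nonempty E] [MeasurableSpace β]
  [IsFiniteMeasure P] {Y : Ω → E} {Z : Ω → β} {R : Set (β × E)}

/-- A regular conditional law of `Y` given the sigma-field `G`: the conditional distribution of `Y`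
given the identity map, viewed as a random element of `(Ω, G)`. -/
def condLaw (P : Measure Ω) [IsFiniteMeasure P] (G : MeasurableSpace Ω) (Y : Ω → E) :
    Ω → Measure E :=
  @condDistrib Ω Ω E _ _ _ mΩ G Y id P _

instance (ω : Ω) : IsProbabilityMeasure (condLaw P G Y ω) :=
  inferInstanceAs (IsProbabilityMeasure (@condDistrib Ω Ω E _ _ _ mΩ G Y id P _ ω))

lemma condProb_prodMk_mem_ae_eq (hG : G ≤ mΩ) (hY : Measurable Y) (hZ : Measurable[G] Z)
    (hR : MeasurableSet R) :
    P⟦{ω | (Z ω, Y ω) ∈ R} | G⟧ =ᵐ[P] fun ω => (condLaw P G Y ω).real {y | (Z ω, y) ∈ R} := by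
  have hS : MeasurableSet[G.prod _] {p : Ω × E | (Z p.1, p.2) ∈ R} :=
    ((hZ.comp measurable_fst).prodMk measurable_snd) hR
  have hS' : MeasurableSet {ω | (Z ω, Y ω) ∈ R} := ((hZ.mono hG le_rfl).prodMk hY) hR
  have condExp_eq := @condExp_prod_ae_eq_integral_condDistrib Ω Ω E ℝ _ _ _ _ mΩ P _ id Y G
    ({p : Ω × E | (Z p.1, p.2) ∈ R}.indicator fun _ => 1) _ _ (measurable_id'' hG) hY.aemeasurable
    (stronglyMeasurable_const.indicator hS) ((integrable_const _).indicator hS')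
  rw [MeasurableSpace.comap_id] at condExp_eq
  refine condExp_eq.trans (ae_of_all _ fun ω => ?_)
  exact integral_indicator_one (s := {y | (Z ω, y) ∈ R}) (measurable_prodMk_left hR)

lemma ae_condLaw_eq_zero (hG : G ≤ mΩ) (hY : Measurable Y) (hZ : Measurable[G] Z)
    (hR : MeasurableSet R) (hnull : P {ω | (Z ω, Y ω) ∈ R} = 0) :
    ∀ᵐ ω ∂P, condLaw P G Y ω {y | (Z ω, y) ∈ R} = 0 := by
  have condProb_eq_zero : P⟦{ω | (Z ω, Y ω) ∈ R} | G⟧ =ᵐ[P] 0 :=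
    (condExp_congr_ae (indicator_meas_zero hnull)).trans (by rw [condExp_zero])
  filter_upwards [condProb_prodMk_mem_ae_eq hG hY hZ hR, condProb_eq_zero] with ω hω hω'
  rwa [← measureReal_eq_zero_iff, ← hω]

end StandardBorel

variable [IsFiniteMeasure P] {Y : Ω → ℝ} {γ : Ω → EReal}

lemma condProb_le_ae_eq_cdf_condLaw (hG : G ≤ mΩ) (hY : Measurable Y) (c : ℝ) :
    P⟦{ω | Y ω ≤ c} | G⟧ =ᵐ[P] fun ω => cdf (condLaw P G Y ω) c := by
  simp only [cdf_eq_real]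
  exact condProb_prodMk_mem_ae_eq (Z := fun _ => ()) (R := {p | p.2 ≤ c}) hG hY measurable_const
    (measurableSet_le measurable_snd measurable_const)

lemma IsCondRightEndpoint.ae_le {P : Measure Ω} [IsProbabilityMeasure P] (hG : G ≤ mΩ)
    (hY : Measurable Y) (hγ : IsCondRightEndpoint G P Y γ) : ∀ᵐ ω ∂P, (Y ω : EReal) ≤ γ ω :=
  (condProb_eq_one_iff P hG (measurableSet_le hY.coe_real_ereal
    (hγ.measurable.mono hG le_rfl))).mp hγ.condProb_eq_one

lemma IsCondRightEndpoint.ae_cdf_condLaw_lt_one (hG : G ≤ mΩ) (hY : Measurable Y)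
    (hγ : IsCondRightEndpoint G P Y γ) :
    ∀ᵐ ω ∂P, ∀ c : ℝ, (c : EReal) < γ ω → cdf (condLaw P G Y ω) c < 1 := by
  have of_rat : ∀ q : ℚ, ∀ᵐ ω ∂P, cdf (condLaw P G Y ω) q = 1 → γ ω ≤ (q : ℝ) := by
    classical
    intro q
    have hcdf := condProb_le_ae_eq_cdf_condLaw (P := P) hG hY q
    set f := P⟦{ω | Y ω ≤ q} | G⟧
    -- An endpoint lowered to `q` where `F q = 1` stays admissible, so minimality gives `γ ≤ q`.
    set γ' : Ω → EReal := fun ω => if f ω = 1 then ((q : ℝ) : EReal) else ⊤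
    have hγ' : Measurable[G] γ' := Measurable.ite
      (stronglyMeasurable_condExp.measurable (measurableSet_singleton (1 : ℝ)))
      measurable_const measurable_const
    have condProb_eq_one : P⟦{ω | (Y ω : EReal) ≤ γ' ω} | G⟧ =ᵐ[P] fun _ => (1 : ℝ) := by
      filter_upwards [hcdf, condProb_prodMk_mem_ae_eq hG hY hγ'
        (measurableSet_le measurable_snd.coe_real_ereal measurable_fst)] with ω hf hω
      refine hω.trans ?_
      by_cases h : f ω = 1
      · rw [h, cdf_eq_real] at hf
        simpa [γ', h, Set.Iic] using hf.symm
      · simp [γ', h]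
    filter_upwards [hcdf, hγ.le_of_condProb_eq_one γ' hγ' condProb_eq_one] with ω hf hle hω
    simpa only [γ', if_pos (hf.trans hω)] using hle
  filter_upwards [ae_all_iff.mpr of_rat] with ω hω c hc
  obtain ⟨q, hcq, hqγ⟩ := EReal.lt_iff_exists_rat_btwn.mp hc
  exact (monotone_cdf _ (EReal.coe_lt_coe_iff.mp hcq).le).trans_lt <|
    (cdf_le_one _ _).lt_of_ne fun h => (hω q h).not_gt hqγ

lemma measurable_ereal_sub_const (b : EReal) : Measurable fun z : EReal => z - b :=
  Monotone.measurable fun _ _ h => EReal.sub_le_sub h le_rfl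

lemma ae_condLaw_singleton_sub_eq_zero (hG : G ≤ mΩ) (hY : Measurable Y) (hγ : Measurable[G] γ)
    {b : ℝ} (hnull : P {ω | (Y ω : EReal) = γ ω - (b : EReal)} = 0) :
    ∀ᵐ ω ∂P, ∀ r : ℝ, γ ω = r → condLaw P G Y ω {r - b} = 0 := by
  filter_upwards [ae_condLaw_eq_zero (R := {p : EReal × ℝ | p.2 = p.1 - (b : EReal)})
    hG hY hγ (measurableSet_eq_fun measurable_snd.coe_real_ereal
      ((measurable_ereal_sub_const b).comp measurable_fst)) hnull] with ω hω r hr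
  convert hω using 2
  ext y
  rw [Set.mem_singleton_iff, Set.mem_ofPred_eq, hr, ← EReal.coe_sub, EReal.coe_eq_coe_iff]

lemma ae_condProb_sub_lt_eq_condLaw_Ioi (hG : G ≤ mΩ) (hY : Measurable Y) (hγ : Measurable[G] γ)
    (b : ℝ) :
    ∀ᵐ ω ∂P, ∀ r : ℝ, γ ω = r → (P⟦{ω' | γ ω' - (b : EReal) < (Y ω' : EReal)} | G⟧) ω =
      (condLaw P G Y ω).real (Set.Ioi (r - b)) := by
  filter_upwards [condProb_prodMk_mem_ae_eq (R := {p : EReal × ℝ | p.1 - (b : EReal) < p.2})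
    hG hY hγ (measurableSet_lt ((measurable_ereal_sub_const b).comp measurable_fst)
      measurable_snd.coe_real_ereal)] with ω hω r hr
  refine hω.trans (congrArg _ ?_)
  ext y
  rw [Set.mem_Ioi, Set.mem_ofPred_eq, hr, ← EReal.coe_sub, EReal.coe_lt_coe_iff]

end ConditionalLaw

section OrderStatistics

lemma orderStat_le_iff (x : ℕ → ℝ) {k n : ℕ} (hk : 1 ≤ k ∧ k ≤ n) {c : ℝ} :
    orderStat x k n ≤ c ↔ k ≤ ((Finset.range n).filter fun i => x i ≤ c).card := by
  set y : Fin n → ℝ := fun i => x i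
  have card_eq : (Finset.univ.filter fun i => (y ∘ Tuple.sort y) i ≤ c).card =
      ((Finset.range n).filter fun i => x i ≤ c).card := by
    simp only [Finset.card_filter, Function.comp_apply]
    rw [Equiv.sum_comp (Tuple.sort y) fun i => if y i ≤ c then 1 else 0, Finset.sum_range]
  have sorted := Tuple.lt_card_le_iff_apply_le_of_monotone (a := c) (j := ⟨k - 1, by omega⟩)
    (Tuple.monotone_sort y)
  rw [card_eq] at sorted
  rw [orderStat, dif_pos hk]
  refine sorted.symm.trans ?_
  dsimp only
  omega

/-- The empirical distribution function of the first `n` terms of a sequence. -/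
def empiricalCDF (x : ℕ → ℝ) (n : ℕ) (c : ℝ) : ℝ :=
  (((Finset.range n).filter fun i => x i ≤ c).card : ℝ) / n

lemma monotone_empiricalCDF (x : ℕ → ℝ) (n : ℕ) : Monotone (empiricalCDF x n) := fun c d hcd => by
  unfold empiricalCDF
  gcongr

lemma birkhoffAverage_shift_indicator_Iic (x : ℕ → ℝ) (n : ℕ) (c : ℝ) :
    birkhoffAverage ℝ shift ({y | y 0 ≤ c}.indicator fun _ => 1) n x = empiricalCDF x n c := by
  simp [birkhoffAverage, birkhoffSum, empiricalCDF, Set.indicator_apply, shift_iterate,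
    inv_mul_eq_div]

lemma empiricalCDF_eq_one {x : ℕ → ℝ} {r : ℝ} (hx : ∀ i, x i ≤ r) {n : ℕ} (hn : n ≠ 0) :
    empiricalCDF x n r = 1 := by
  simp [empiricalCDF, hx, hn]

lemma nearCount_div_le (x : ℕ → ℝ) (k n : ℕ) (a : ℝ) :
    (nearCount x k n a : ℝ) / n ≤ 1 - empiricalCDF x n (orderStat x k n - a) := by
  set near := (Finset.range n).filter fun i =>
    orderStat x k n - a < x i ∧ x i < orderStat x k n
  set below := (Finset.range n).filter fun i => x i ≤ orderStat x k n - a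
  have hdisj : Disjoint near below := Finset.disjoint_filter.mpr fun i _ hi => hi.1.not_ge
  have card_add_le : near.card + below.card ≤ n := by
    rw [← Finset.card_union_of_disjoint hdisj]
    exact (Finset.card_le_card (Finset.union_subset (Finset.filter_subset _ _)
      (Finset.filter_subset _ _))).trans_eq (Finset.card_range n)
  rw [le_sub_iff_add_le, empiricalCDF, ← add_div]
  exact div_le_one_of_le₀ (mod_cast card_add_le) n.cast_nonneg

lemma empiricalCDF_sub_le_nearCount_div (x : ℕ → ℝ) (k n : ℕ) (a : ℝ) {c : ℝ}
    (hc : c < orderStat x k n) :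
    empiricalCDF x n c - empiricalCDF x n (orderStat x k n - a) ≤ (nearCount x k n a : ℝ) / n := by
  have card_le : ((Finset.range n).filter fun i => x i ≤ c).card ≤ nearCount x k n a +
      ((Finset.range n).filter fun i => x i ≤ orderStat x k n - a).card := by
    refine (Finset.card_le_card fun i hi => ?_).trans (Finset.card_union_le _ _)
    grind
  rw [sub_le_iff_le_add, empiricalCDF, empiricalCDF, ← add_div]
  gcongr
  exact_mod_cast card_le

lemma tendsto_comp_of_monotone_of_forall_rat {F : ℝ → ℝ} {f : ℕ → ℝ → ℝ}
    (hf : ∀ n, Monotone (f n)) (hlim : ∀ q : ℚ, Tendsto (f · q) atTop (𝓝 (F q))) {c : ℝ}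
    (hF : ContinuousAt F c) {u : ℕ → ℝ} (hu : Tendsto u atTop (𝓝 c)) :
    Tendsto (fun n => f n (u n)) atTop (𝓝 (F c)) := by
  refine tendsto_order.mpr ⟨fun l hl => ?_, fun l hl => ?_⟩
  · obtain ⟨b, hbc, hb⟩ := exists_Ioc_subset_of_mem_nhds (hF.eventually_const_lt hl) (exists_lt c)
    obtain ⟨q, hbq, hqc⟩ := exists_rat_btwn hbc
    filter_upwards [(hlim q).eventually_const_lt (hb ⟨hbq, hqc.le⟩), hu.eventually_const_lt hqc]
      with n hn hqu
    exact hn.trans_le (hf n hqu.le)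
  · obtain ⟨b, hcb, hb⟩ := exists_Ico_subset_of_mem_nhds (hF.eventually_lt_const hl) (exists_gt c)
    obtain ⟨q, hcq, hqb⟩ := exists_rat_btwn hcb
    filter_upwards [(hlim q).eventually_lt_const (hb ⟨hcq.le, hqb⟩), hu.eventually_lt_const hcq]
      with n hn huq
    exact (hf n huq.le).trans_lt hn

lemma continuousAt_cdf {ν : Measure ℝ} [IsProbabilityMeasure ν] {c : ℝ} (hc : ν {c} = 0) :
    ContinuousAt (cdf ν) c := by
  rw [(monotone_cdf ν).continuousAt_iff_leftLim_eq_rightLim, StieltjesFunction.rightLim_eq]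
  refine ((monotone_cdf ν).leftLim_le le_rfl).antisymm (sub_nonpos.mp ?_)
  rwa [← measure_cdf (μ := ν), StieltjesFunction.measure_singleton, ENNReal.ofReal_eq_zero] at hc

variable {x : ℕ → ℝ} {k : ℕ → ℕ} {ν : Measure ℝ}

lemma eventually_lt_orderStat (hk : ∀ n, 1 ≤ n → 1 ≤ k n ∧ k n ≤ n)
    (hk1 : Tendsto (fun n : ℕ => (k n : ℝ) / n) atTop (𝓝 1))
    (hF : ∀ q : ℚ, Tendsto (empiricalCDF x · q) atTop (𝓝 (cdf ν q))) {c d : ℝ} (hcd : c < d)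
    (hd : cdf ν d < 1) : ∀ᶠ n in atTop, c < orderStat x (k n) n := by
  obtain ⟨q, hcq, hqd⟩ := exists_rat_btwn hcd
  filter_upwards [(hF q).eventually_lt hk1 ((monotone_cdf ν hqd.le).trans_lt hd),
    eventually_ge_atTop 1] with n hn hn1
  refine hcq.trans (not_le.mp fun hle => hn.not_ge ?_)
  unfold empiricalCDF
  gcongr
  exact (orderStat_le_iff x (hk n hn1)).mp hle

theorem tendsto_nearCount_div_zero (hk : ∀ n, 1 ≤ n → 1 ≤ k n ∧ k n ≤ n)
    (hk1 : Tendsto (fun n : ℕ => (k n : ℝ) / n) atTop (𝓝 1))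
    (hF : ∀ q : ℚ, Tendsto (empiricalCDF x · q) atTop (𝓝 (cdf ν q))) (hlt : ∀ c, cdf ν c < 1)
    (a : ℝ) : Tendsto (fun n : ℕ => (nearCount x (k n) n a : ℝ) / n) atTop (𝓝 0) := by
  refine tendsto_order.mpr
    ⟨fun l hl => .of_forall fun n => hl.trans_le (by positivity), fun ε hε => ?_⟩
  obtain ⟨q, hq⟩ : ∃ q : ℚ, 1 - ε < cdf ν q := by
    obtain ⟨c, hc⟩ := ((tendsto_cdf_atTop ν).eventually_const_lt (sub_lt_self 1 hε)).exists
    obtain ⟨q, hcq⟩ := exists_rat_gt c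
    exact ⟨q, hc.trans_le (monotone_cdf ν hcq.le)⟩
  filter_upwards [(hF q).eventually_const_lt hq,
    eventually_lt_orderStat hk hk1 hF (lt_add_one (q + a)) (hlt _)] with n hn hM
  calc (nearCount x (k n) n a : ℝ) / n
      ≤ 1 - empiricalCDF x n (orderStat x (k n) n - a) := nearCount_div_le x (k n) n a
    _ ≤ 1 - empiricalCDF x n q := sub_le_sub_left (monotone_empiricalCDF x n (by linarith)) 1
    _ < ε := by linarith

lemma tendsto_orderStat (hk : ∀ n, 1 ≤ n → 1 ≤ k n ∧ k n ≤ n)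
    (hk1 : Tendsto (fun n : ℕ => (k n : ℝ) / n) atTop (𝓝 1))
    (hF : ∀ q : ℚ, Tendsto (empiricalCDF x · q) atTop (𝓝 (cdf ν q))) {r : ℝ}
    (hx : ∀ i, x i ≤ r) (hlt : ∀ c < r, cdf ν c < 1) :
    Tendsto (fun n => orderStat x (k n) n) atTop (𝓝 r) := by
  refine tendsto_order.mpr ⟨fun c hc => ?_, fun c hc => ?_⟩
  · obtain ⟨d, hcd, hdr⟩ := exists_between hc
    exact eventually_lt_orderStat hk hk1 hF hcd (hlt d hdr)
  · filter_upwards [eventually_ge_atTop 1] with n hn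
    refine lt_of_le_of_lt ((orderStat_le_iff x (hk n hn)).mpr ?_) hc
    simpa [hx] using (hk n hn).2

theorem tendsto_nearCount_div [IsProbabilityMeasure ν] (hk : ∀ n, 1 ≤ n → 1 ≤ k n ∧ k n ≤ n)
    (hk1 : Tendsto (fun n : ℕ => (k n : ℝ) / n) atTop (𝓝 1))
    (hF : ∀ q : ℚ, Tendsto (empiricalCDF x · q) atTop (𝓝 (cdf ν q))) {r : ℝ}
    (hx : ∀ i, x i ≤ r) (hlt : ∀ c < r, cdf ν c < 1) {a : ℝ} (hr : ν {r} = 0)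
    (hra : ν {r - a} = 0) :
    Tendsto (fun n : ℕ => (nearCount x (k n) n a : ℝ) / n) atTop
      (𝓝 (ν.real (Set.Ioi (r - a)))) := by
  have empirical_limit {c : ℝ} (hc : ν {c} = 0) {u : ℕ → ℝ} (hu : Tendsto u atTop (𝓝 c)) :
      Tendsto (fun n => empiricalCDF x n (u n)) atTop (𝓝 (cdf ν c)) :=
    tendsto_comp_of_monotone_of_forall_rat (monotone_empiricalCDF x) hF (continuousAt_cdf hc) hu
  have cdf_eq_one : cdf ν r = 1 :=
    tendsto_nhds_unique (empirical_limit hr tendsto_const_nhds) <|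
      tendsto_const_nhds.congr' <| (eventually_ne_atTop 0).mono fun n hn =>
        (empiricalCDF_eq_one hx hn).symm
  have hM := tendsto_orderStat hk hk1 hF hx hlt
  have hMa := empirical_limit hra (hM.sub_const a)
  have hM' := empirical_limit hr (u := fun n => orderStat x (k n) n - 1 / ((n : ℝ) + 1)) <| by
    simpa using hM.sub tendsto_one_div_add_atTop_nhds_zero_nat
  have limit_eq : ν.real (Set.Ioi (r - a)) = 1 - cdf ν (r - a) := by
    rw [← Set.compl_Iic, probReal_compl_eq_one_sub measurableSet_Iic, cdf_eq_real]
  rw [limit_eq]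
  refine tendsto_of_tendsto_of_tendsto_of_le_of_le (cdf_eq_one ▸ hM'.sub hMa) (hMa.const_sub 1)
    (fun n => empiricalCDF_sub_le_nearCount_div x (k n) n a (sub_lt_self _ ?_))
    fun n => nearCount_div_le x (k n) n a
  positivity

end OrderStatistics

section NearMaxima

variable {Ω : Type*} [MeasurableSpace Ω] {P : Measure Ω} {X : ℕ → Ω → ℝ}
  {γ : Ω → EReal} {k : ℕ → ℕ}

theorem StrictlyStationary.ae_tendsto_empiricalCDF [IsFiniteMeasure P]
    (hstat : StrictlyStationary P X) (hX : ∀ i, Measurable (X i)) (c : ℝ) :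
    ∀ᵐ ω ∂P, Tendsto (empiricalCDF (fun i => X i ω) · c) atTop
      (𝓝 (cdf (condLaw P (invariantSigma X) (X 0) ω) c)) := by
  have hf : Integrable ({y : ℕ → ℝ | y 0 ≤ c}.indicator fun _ => (1 : ℝ)) (P.map (path X)) :=
    (integrable_const _).indicator (measurableSet_le (measurable_pi_apply 0) measurable_const)
  filter_upwards [hstat.ae_tendsto_birkhoffAverage hX hf,
    condProb_le_ae_eq_cdf_condLaw (P := P) (invariantSigma_le hX) (hX 0) c] with ω hω hcdf
  simp only [birkhoffAverage_shift_indicator_Iic] at hω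
  rw [← hcdf]
  exact hω

theorem ae_tendsto_nearCount_div_of_eq_top [IsFiniteMeasure P] (hX : ∀ i, Measurable (X i))
    (hstat : StrictlyStationary P X) (hk : ∀ n, 1 ≤ n → 1 ≤ k n ∧ k n ≤ n)
    (hk1 : Tendsto (fun n : ℕ => (k n : ℝ) / n) atTop (𝓝 1))
    (hγ : IsCondRightEndpoint (invariantSigma X) P (X 0) γ) (a : ℝ) :
    ∀ᵐ ω ∂P, γ ω = ⊤ →
      Tendsto (fun n : ℕ => (nearCount (fun i => X i ω) (k n) n a : ℝ) / n) atTop (𝓝 0) := by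
  filter_upwards [ae_all_iff.mpr fun q : ℚ => hstat.ae_tendsto_empiricalCDF hX q,
    hγ.ae_cdf_condLaw_lt_one (invariantSigma_le hX) (hX 0)] with ω hF hlt htop
  exact tendsto_nearCount_div_zero hk hk1 hF (fun c => hlt c (htop ▸ EReal.coe_lt_top c)) a

theorem ae_tendsto_nearCount_div_of_lt_top [IsProbabilityMeasure P] (hX : ∀ i, Measurable (X i))
    (hstat : StrictlyStationary P X) (hk : ∀ n, 1 ≤ n → 1 ≤ k n ∧ k n ≤ n)
    (hk1 : Tendsto (fun n : ℕ => (k n : ℝ) / n) atTop (𝓝 1))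
    (hγ : IsCondRightEndpoint (invariantSigma X) P (X 0) γ) {a : ℝ}
    (hnull : P {ω | (X 0 ω : EReal) = γ ω} = 0)
    (hnull_sub : P {ω | (X 0 ω : EReal) = γ ω - (a : EReal)} = 0) :
    ∀ᵐ ω ∂P, γ ω < ⊤ →
      Tendsto (fun n : ℕ => (nearCount (fun i => X i ω) (k n) n a : ℝ) / n) atTop
        (𝓝 ((P⟦{ω' | γ ω' - (a : EReal) < (X 0 ω' : EReal)} | invariantSigma X⟧) ω)) := by
  have hG := invariantSigma_le hX
  filter_upwards [ae_all_iff.mpr fun q : ℚ => hstat.ae_tendsto_empiricalCDF hX q,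
    hstat.ae_forall_le hγ.measurable (hγ.ae_le hG (hX 0)), hγ.ae_cdf_condLaw_lt_one hG (hX 0),
    ae_condLaw_singleton_sub_eq_zero (b := 0) hG (hX 0) hγ.measurable (by simpa using hnull),
    ae_condLaw_singleton_sub_eq_zero hG (hX 0) hγ.measurable hnull_sub,
    ae_condProb_sub_lt_eq_condLaw_Ioi hG (hX 0) hγ.measurable a]
    with ω hF hle hlt hr hra hlimit htop
  obtain ⟨r, hγr⟩ : ∃ r : ℝ, γ ω = r :=
    ⟨_, (EReal.coe_toReal htop.ne ((EReal.bot_lt_coe _).trans_le (hle 0)).ne').symm⟩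
  simp only [hγr, EReal.coe_le_coe_iff, EReal.coe_lt_coe_iff] at hle hlt
  rw [hlimit r hγr]
  exact tendsto_nearCount_div hk hk1 hF hle hlt (by simpa using hr r hγr) (hra r hγr)

end NearMaxima

end NearMax

end

theorem theorem3p4 {Ω : Type*} [MeasurableSpace Ω] (P : Measure Ω) [IsProbabilityMeasure P]
    (X : ℕ → Ω → ℝ) (hX : ∀ i, Measurable (X i)) (hstat : NearMax.StrictlyStationary P X)
    (k : ℕ → ℕ) (hk : ∀ n, 1 ≤ n → 1 ≤ k n ∧ k n ≤ n)
    (hk1 : Tendsto (fun n : ℕ => (k n : ℝ) / (n : ℝ)) atTop (𝓝 1))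
    (a : ℝ) (ha : 0 < a)
    (γ : Ω → EReal)
    (hγ : NearMax.IsCondRightEndpoint (NearMax.invariantSigma X) P (X 0) γ) :
    (P {ω | (X 0 ω : EReal) = γ ω} = 0 →
      P {ω | (X 0 ω : EReal) = γ ω - (a : EReal)} = 0 →
      (∀ᵐ ω ∂P, Tendsto
          (fun n : ℕ => (NearMax.nearCount (fun i => X i ω) (k n) n a : ℝ) / (n : ℝ)) atTop
          (𝓝 ({ω' | γ ω' < ⊤}.indicator (fun _ => (1 : ℝ)) ω *
            (P⟦{ω' | γ ω' - (a : EReal) < (X 0 ω' : EReal)} | NearMax.invariantSigma X⟧) ω))) ∧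
      (∀ᵐ ω ∂P, γ ω = ⊤ → Tendsto
          (fun n : ℕ => (NearMax.nearCount (fun i => X i ω) (k n) n a : ℝ) / (n : ℝ)) atTop
          (𝓝 0))) ∧
    ((∀ᵐ ω ∂P, γ ω = ⊤) → ∀ᵐ ω ∂P, Tendsto
      (fun n : ℕ => (NearMax.nearCount (fun i => X i ω) (k n) n a : ℝ) / (n : ℝ)) atTop
      (𝓝 0)) := by
  have htop := NearMax.ae_tendsto_nearCount_div_of_eq_top hX hstat hk hk1 hγ a
  refine ⟨fun hnull hnull_sub => ⟨?_, htop⟩, fun h => ?_⟩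
  · filter_upwards [htop,
      NearMax.ae_tendsto_nearCount_div_of_lt_top hX hstat hk hk1 hγ hnull hnull_sub]
      with ω of_eq_top of_lt_top
    by_cases hω : γ ω < ⊤
    · rw [Set.indicator_of_mem (by exact hω), one_mul]
      exact of_lt_top hω
    · rw [Set.indicator_of_notMem (by exact hω), zero_mul]
      exact of_eq_top (not_lt_top_iff.mp hω)
  · filter_upwards [htop, h] with ω of_eq_top hω
    exact of_eq_top hω
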